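/- For $a,b,x\in\mathbb{C}$ with $b\notin\{0,-1,-2,\dots\}$ let ${}_1F_1(a,b,x)=\sum_{n\ge 0}\frac{(a)_n}{(b)_n\,n!}x^n$ be the confluent hypergeometric function, where $(a)_0=1$ and $(a)_n=a(a+1)\cdots(a+n-1)$. For $\tau\in\mathbb{C}$ the Hermite function of degree $\tau$ is $$H_\tau(x)=2^\tau\frac{\Gamma(\frac12)}{\Gamma(\frac{1-\tau}{2})}\,{}_1F_1\!\left(-\tfrac{\tau}{2},\tfrac12,x^2\right)+2^\tau x\,\frac{\Gamma(-\frac12)}{\Gamma(-\frac{\tau}{2})}\,{}_1F_1\!\left(\tfrac{1-\tau}{2},\tfrac32,x^2\right),$$ where here and below $1/\Gamma$ denotes the entire function that vanishes at $0,-1,-2,\dots$. For each $(z,\tau)\in\mathbb{C}^2$ with $\Re(z)>-1$, both of the following integrals converge absolutely, and $$\int_0^\infty x^{z}H_\tau(x)e^{-x^2}\,dx=\frac{\sqrt{\pi}}{2^{z-\tau+1}}\,\frac{\Gamma(z+1)}{\Gamma(\frac{z-\tau}{2}+1)},$$ $$\int_{-\infty}^{\infty}|x|^{z}H_\tau(|x|)e^{-x^2}\,dx=\frac{\sqrt{\pi}}{2^{z-\tau}}\,\frac{\Gamma(z+1)}{\Gamma(\frac{z-\tau}{2}+1)}.$$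 -/

import Mathlib

/-- Kummer's confluent hypergeometric function
`₁F₁(a, b, z) = ∑ₙ (a)ₙ / ((b)ₙ n!) zⁿ`, where `b` is not a non-positive integer.
Mathlib's regularized hypergeometric function carries an additional factor `1 / Γ(b)`. -/
noncomputable def confluentHypergeometric (a b z : ℂ) : ℂ :=
  Complex.Gamma b * Complex.regularizedHGFun {a} {b} z

/-- The defining power series of `₁F₁(a, b, z)` converges for every `z`. -/
theorem confluentHypergeometric_hasSum (a b z : ℂ) (hb : ∀ k : ℕ, b ≠ -k) :
    HasSum (fun n : ℕ => (ascPochhammer ℂ n).eval a /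
      ((ascPochhammer ℂ n).eval b * (n.factorial : ℂ)) * z ^ n)
      (confluentHypergeometric a b z) := by
  have hr : (Complex.regularizedHGFunSeries {a} {b}).radius = ⊤ :=
    Complex.radius_regularizedHGFunSeries_eq_top (by simp)
  have h := ((Complex.regularizedHGFunSeries {a} {b}).hasSum (x := z)
    (by rw [hr]; simp)).mul_left (Complex.Gamma b)
  unfold confluentHypergeometric Complex.regularizedHGFun
  refine (congrArg (fun f : ℕ → ℂ => HasSum f _) (funext fun n => ?_)).mpr h
  have hG : Complex.Gamma b ≠ 0 := Complex.Gamma_ne_zero hb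
  rw [← Complex.Gamma_add_nat_div_Gamma_eq b hb]
  have hG' : Complex.Gamma (b + n) ≠ 0 := by
    apply Complex.Gamma_ne_zero
    intro m hm
    apply hb (m + n)
    push_cast
    linear_combination hm
  have hf : (n.factorial : ℂ) ≠ 0 := by exact_mod_cast n.factorial_ne_zero
  simp [Complex.regularizedHGFunSeries, Complex.regularizedHGFunCoeff]
  field_simp

/-- The Hermite function `H_τ(x)` of complex degree `τ`. Mathlib's value `0` for `Γ` at its poles
together with `c / 0 = 0` agrees with the convention that the entire function `1 / Γ` vanishes
at the non-positive integers. -/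
noncomputable def hermiteFunction (τ x : ℂ) : ℂ :=
  2 ^ τ * (Complex.Gamma (1 / 2) / Complex.Gamma ((1 - τ) / 2)) *
      confluentHypergeometric (-τ / 2) (1 / 2) (x ^ 2)
    + 2 ^ τ * x * (Complex.Gamma (-1 / 2) / Complex.Gamma (-τ / 2)) *
      confluentHypergeometric ((1 - τ) / 2) (3 / 2) (x ^ 2)

/-! For `Re τ < 0`, `Γ(-τ) H_τ(x) = ∫₀^∞ t^(-τ-1) exp(-t² - 2xt) dt`. Multiplying by `x^z exp(-x²)`
completes the square to `exp(-(x+t)²)`. With `s = t + x`, Fubini leaves a Beta integral over `0 < t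
< s` times a Gaussian Mellin integral in `s`; Legendre duplication gives the closed form
(`hermiteFunction_moment_of_re_neg`). The recurrence `hermiteFunction_add_one` expresses the moment
at `(z, τ+1)` through those at `(z+1, τ)` and `(z, τ-1)`. The closed form obeys the same relation,
so induction on a natural bound for `Re τ` reaches every degree. The integral over the whole line
follows by evenness. -/

section

open MeasureTheory Set

/-! ### Contiguous relations and the recurrence in the degree -/

theorem ascPochhammer_eval_succ_left (a : ℂ) (n : ℕ) :
    (ascPochhammer ℂ (n + 1)).eval a = a * (ascPochhammer ℂ n).eval (a + 1) := by
  simp [ascPochhammer_succ_left]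

/-- Contiguous relation `M(a - 1, b, z) = M(a, b, z) - (z / b) M(a, b + 1, z)`. -/
theorem confluentHypergeometric_sub_one (a b z : ℂ) (hb : ∀ k : ℕ, b ≠ -k) :
    confluentHypergeometric (a - 1) b z =
      confluentHypergeometric a b z - z / b * confluentHypergeometric a (b + 1) z := by
  have hb1 : ∀ k : ℕ, b + 1 ≠ -k := fun k h => hb (k + 1) (by push_cast; linear_combination h)
  have hd := (confluentHypergeometric_hasSum (a - 1) b z hb).sub
    (confluentHypergeometric_hasSum a b z hb)
  have hs := (hasSum_nat_add_iff' 1).mpr hd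
  have hr := (confluentHypergeometric_hasSum a (b + 1) z hb1).mul_left (-(z / b))
  have hb0 : b ≠ 0 := by simpa using hb 0
  have := hs.unique (hr.congr_fun ?_)
  · simp at this
    linear_combination this
  · intro n
    have hn : (n : ℂ) + 1 ≠ 0 := Nat.cast_add_one_ne_zero n
    rw [ascPochhammer_eval_succ_left (a - 1), ascPochhammer_eval_succ_left b,
      ascPochhammer_succ_eval, Nat.factorial_succ, sub_add_cancel]
    push_cast
    field_simp
    ring

/-- Contiguous relation `(b - a) M(a, b + 1, z) = b M(a, b, z) - a M(a + 1, b + 1, z)`. -/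
theorem sub_mul_confluentHypergeometric_add_one (a b z : ℂ) (hb : ∀ k : ℕ, b ≠ -k) :
    (b - a) * confluentHypergeometric a (b + 1) z =
      b * confluentHypergeometric a b z -
        a * confluentHypergeometric (a + 1) (b + 1) z := by
  have hb1 : ∀ k : ℕ, b + 1 ≠ -k := fun k h => hb (k + 1) (by push_cast; linear_combination h)
  refine ((confluentHypergeometric_hasSum a (b + 1) z hb1).mul_left (b - a)).unique
    ((((confluentHypergeometric_hasSum a b z hb).mul_left b).sub
      ((confluentHypergeometric_hasSum (a + 1) (b + 1) z hb1).mul_left a)).congr_fun ?_)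
  intro n
  have h1 := ascPochhammer_eval_succ_left a n
  have h2 := ascPochhammer_eval_succ_left b n
  rw [ascPochhammer_succ_eval] at h1 h2
  have hb0 : b ≠ 0 := by simpa using hb 0
  have hbn : b + n ≠ 0 := fun h => hb n (by linear_combination h)
  have h3 : (ascPochhammer ℂ n).eval b =
      b * (ascPochhammer ℂ n).eval (b + 1) / (b + n) := by
    field_simp; linear_combination h2
  rw [h3]
  field_simp
  linear_combination (-(z ^ n / ((ascPochhammer ℂ n).eval (b + 1) * (n.factorial : ℂ)))) * h1

theorem Complex.Gamma_one_half_eq_sqrt_pi : Complex.Gamma (1 / 2) = (Real.sqrt Real.pi : ℂ) := by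
  rw [← Real.Gamma_one_half_eq, ← Complex.Gamma_ofReal]
  norm_num

theorem Complex.Gamma_neg_one_half_eq :
    Complex.Gamma (-1 / 2) = -2 * (Real.sqrt Real.pi : ℂ) := by
  have h := Complex.Gamma_add_one (-1 / 2) (by norm_num)
  rw [show (-1 / 2 + 1 : ℂ) = 1 / 2 by norm_num, Complex.Gamma_one_half_eq_sqrt_pi] at h
  linear_combination 2 * h

theorem one_half_ne_neg_nat (k : ℕ) : (1 / 2 : ℂ) ≠ -k := by
  intro h
  have := congrArg Complex.re h
  simp at this
  have hk : (0 : ℝ) ≤ k := k.cast_nonneg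
  linarith

/-- The three-term recurrence `H_{τ+1}(x) = 2 x H_τ(x) - 2 τ H_{τ-1}(x)`. -/
theorem hermiteFunction_add_one (τ x : ℂ) :
    hermiteFunction (τ + 1) x =
      2 * x * hermiteFunction τ x - 2 * τ * hermiteFunction (τ - 1) x := by
  have hE := confluentHypergeometric_sub_one ((1 - τ) / 2) (1 / 2) (x ^ 2) one_half_ne_neg_nat
  have hO := sub_mul_confluentHypergeometric_add_one (-τ / 2) (1 / 2) (x ^ 2) one_half_ne_neg_nat
  -- The reciprocal form of the functional equation holds at the poles of `Γ` too, so no case split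
  -- on `τ` is needed.
  have g1 := Complex.one_div_Gamma_eq_self_mul_one_div_Gamma_add_one (-τ / 2)
  have g2 := Complex.one_div_Gamma_eq_self_mul_one_div_Gamma_add_one (-(τ + 1) / 2)
  have p1 : (2 : ℂ) ^ (τ + 1) = 2 ^ τ * 2 := by
    rw [Complex.cpow_add _ _ two_ne_zero, Complex.cpow_one]
  have p2 : (2 : ℂ) ^ (τ - 1) = 2 ^ τ / 2 := by
    rw [Complex.cpow_sub _ _ two_ne_zero, Complex.cpow_one]
  rw [show (1 - τ) / 2 - 1 = -(τ + 1) / 2 by ring, show (1 / 2 + 1 : ℂ) = 3 / 2 by norm_num] at hE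
  rw [show -τ / 2 + 1 = (1 - (τ - 1)) / 2 by ring, show (1 / 2 + 1 : ℂ) = 3 / 2 by norm_num] at hO
  rw [show -τ / 2 + 1 = (1 - (τ - 1)) / 2 by ring] at g1
  rw [show -(τ + 1) / 2 + 1 = (1 - τ) / 2 by ring] at g2
  unfold hermiteFunction
  rw [Complex.Gamma_one_half_eq_sqrt_pi, Complex.Gamma_neg_one_half_eq, p1, p2,
    show (1 - (τ + 1)) / 2 = -τ / 2 by ring, show -(τ - 1) / 2 = (1 - τ) / 2 by ring]
  simp only [div_eq_mul_inv (_ : ℂ) (Complex.Gamma _), g2, g1, hE]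
  linear_combination (4 * x * 2 ^ τ * (Real.sqrt Real.pi : ℂ) *
    (Complex.Gamma ((1 - τ) / 2))⁻¹) * hO

/-! ### Gaussian Mellin integrals and even extension -/

/-- The Mellin transform of the Gaussian. -/
theorem integral_cpow_mul_cexp_neg_sq (w : ℂ) (hw : 0 < w.re) :
    ∫ t in Ioi (0 : ℝ), (t : ℂ) ^ (w - 1) * Complex.exp (-(t : ℂ) ^ 2) =
      Complex.Gamma (w / 2) / 2 := by
  have h := mellin_comp_rpow (fun t : ℝ => Complex.exp (-(t : ℂ))) w 2
  have hw2 : 0 < (w / ((2 : ℝ) : ℂ)).re := by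
    rw [Complex.div_ofReal_re]; positivity
  have hG : mellin (fun t : ℝ => Complex.exp (-(t : ℂ))) (w / ((2 : ℝ) : ℂ)) =
      Complex.Gamma (w / ((2 : ℝ) : ℂ)) := by
    rw [Complex.Gamma_eq_integral hw2, Complex.GammaIntegral_eq_mellin]
    simp [mellin]
  rw [hG] at h
  unfold mellin at h
  simp only [Real.rpow_two, smul_eq_mul, Complex.ofReal_pow] at h
  rw [h]
  simp
  ring

theorem integrableOn_cpow_mul_cexp_neg_sq (w : ℂ) (hw : 0 < w.re) :
    IntegrableOn (fun t : ℝ => (t : ℂ) ^ (w - 1) * Complex.exp (-(t : ℂ) ^ 2)) (Ioi 0) := by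
  have h := integrableOn_rpow_mul_exp_neg_mul_sq (b := 1) one_pos (s := w.re - 1) (by linarith)
  refine Integrable.mono' h ?_ ?_
  · exact Measurable.aestronglyMeasurable (by fun_prop)
  · filter_upwards [ae_restrict_mem measurableSet_Ioi] with t ht
    rw [norm_mul, Complex.norm_cpow_eq_rpow_re_of_pos ht, ← Complex.ofReal_pow,
      ← Complex.ofReal_neg, Complex.norm_exp_ofReal]
    simp

theorem integrable_comp_abs {f : ℝ → ℂ} (hf : IntegrableOn f (Ioi 0)) :
    Integrable (fun x => f |x|) := by
  have h1 : IntegrableOn (fun x => f |x|) (Ioi 0) :=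
    hf.congr_fun (fun x hx => by rw [abs_of_pos hx]) measurableSet_Ioi
  have h2 : IntegrableOn (fun x => f |x|) (Iic 0) := by
    have := Iff.mpr integrableOn_Ici_iff_integrableOn_Ioi h1
    rw [← neg_zero] at this
    simpa using this.comp_neg_Iic
  rw [← integrableOn_univ, ← Iic_union_Ioi (a := (0 : ℝ))]
  exact h2.union h1

theorem integral_comp_abs_complex {f : ℝ → ℂ} (hf : IntegrableOn f (Ioi 0)) :
    ∫ x, f |x| = 2 * ∫ x in Ioi (0 : ℝ), f x := by
  have h := integrable_comp_abs hf
  have h1 : ∫ x in Ioi (0 : ℝ), f |x| = ∫ x in Ioi (0 : ℝ), f x :=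
    setIntegral_congr_fun measurableSet_Ioi (fun x hx => by rw [abs_of_pos hx])
  have h2 := integral_comp_neg_Ioi 0 (fun x => f |x|)
  simp only [abs_neg, neg_zero] at h2
  rw [← intervalIntegral.integral_Iic_add_Ioi h.integrableOn h.integrableOn (b := 0), ← h2, h1]
  ring

/-! ### The Beta–Gaussian double integral -/

/-- The Beta integrand on `0 < t < s` weighted by the Gaussian in `s`. -/
noncomputable def gaussianBetaKernel (u v : ℂ) (p : ℝ × ℝ) : ℂ :=
  {p : ℝ × ℝ | 0 < p.1 ∧ p.1 < p.2}.indicator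
    (fun p => (p.1 : ℂ) ^ (u - 1) * ((p.2 - p.1 : ℝ) : ℂ) ^ (v - 1) *
      Complex.exp (-(p.2 : ℂ) ^ 2)) p

theorem measurable_gaussianBetaKernel (u v : ℂ) : Measurable (gaussianBetaKernel u v) := by
  refine Measurable.indicator (by fun_prop) ?_
  exact (measurableSet_lt measurable_const measurable_fst).inter
    (measurableSet_lt measurable_fst measurable_snd)

theorem gaussianBetaKernel_of_nonpos (u v : ℂ) {s : ℝ} (hs : s ≤ 0) (t : ℝ) :
    gaussianBetaKernel u v (t, s) = 0 :=
  indicator_of_notMem (fun h => by linarith [h.1.trans h.2]) _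

theorem gaussianBetaKernel_eq_indicator (u v : ℂ) (s t : ℝ) :
    gaussianBetaKernel u v (t, s) = (Ioo 0 s).indicator (fun t : ℝ =>
      (t : ℂ) ^ (u - 1) * ((s : ℂ) - t) ^ (v - 1) * Complex.exp (-(s : ℂ) ^ 2)) t := by
  simp [gaussianBetaKernel, indicator_apply]

/-- Positive bases give `|t^w| = t^(Re w)`, so absolute integrability reduces to evaluating the same
kernel at real parameters. -/
theorem norm_gaussianBetaKernel (u v : ℂ) (p : ℝ × ℝ) :
    (‖gaussianBetaKernel u v p‖ : ℂ) = gaussianBetaKernel u.re v.re p := by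
  unfold gaussianBetaKernel
  by_cases h : p ∈ {p : ℝ × ℝ | 0 < p.1 ∧ p.1 < p.2}
  · have h2 : 0 < p.2 - p.1 := sub_pos.mpr h.2
    rw [indicator_of_mem h, indicator_of_mem h, norm_mul, norm_mul,
      Complex.norm_cpow_eq_rpow_re_of_pos h.1, Complex.norm_cpow_eq_rpow_re_of_pos h2,
      ← Complex.ofReal_pow, ← Complex.ofReal_neg, Complex.norm_exp_ofReal]
    push_cast [Complex.ofReal_cpow h.1.le, Complex.ofReal_cpow h2.le]
    simp
  · simp [indicator_of_notMem h]

theorem intervalIntegrable_beta_scaled {u v : ℂ} (hu : 0 < u.re) (hv : 0 < v.re) {s : ℝ}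
    (hs : 0 < s) :
    IntervalIntegrable (fun t : ℝ => (t : ℂ) ^ (u - 1) * ((s : ℂ) - t) ^ (v - 1))
      volume 0 s := by
  have h := ((Complex.betaIntegral_convergent hu hv).comp_mul_right (c := s⁻¹)).const_mul
    ((s : ℂ) ^ (u - 1) * (s : ℂ) ^ (v - 1))
  simp only [zero_div, one_div, inv_inv] at h
  refine h.congr_uIoo ?_
  intro t ht
  rw [uIoo_of_le hs.le] at ht
  have hs0 : (s : ℂ) ≠ 0 := Complex.ofReal_ne_zero.mpr hs.ne'
  have h1 : (t : ℂ) = (s : ℂ) * ((t * s⁻¹ : ℝ) : ℂ) := by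
    push_cast
    field_simp
  have h2 : (s : ℂ) - t = (s : ℂ) * ((1 - t * s⁻¹ : ℝ) : ℂ) := by
    push_cast
    field_simp
  have h3 : 0 ≤ t * s⁻¹ := by have := ht.1; positivity
  have h4 : 0 ≤ 1 - t * s⁻¹ := by
    rw [← div_eq_mul_inv, sub_nonneg, div_le_one hs]; exact ht.2.le
  simp only
  rw [h2]
  conv_rhs => rw [h1]
  rw [Complex.mul_cpow_ofReal_nonneg hs.le h3, Complex.mul_cpow_ofReal_nonneg hs.le h4]
  push_cast
  ring

theorem integrable_gaussianBetaKernel_left {u v : ℂ} (hu : 0 < u.re) (hv : 0 < v.re) (s : ℝ) :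
    Integrable (fun t => gaussianBetaKernel u v (t, s)) := by
  rcases le_or_gt s 0 with hs | hs
  · simp [gaussianBetaKernel_of_nonpos u v hs]
  · simp_rw [gaussianBetaKernel_eq_indicator]
    rw [integrable_indicator_iff measurableSet_Ioo]
    have h := (intervalIntegrable_beta_scaled hu hv hs).mul_const (Complex.exp (-(s : ℂ) ^ 2))
    rwa [intervalIntegrable_iff_integrableOn_Ioo_of_le hs.le] at h

theorem integral_gaussianBetaKernel_left (u v : ℂ) (s : ℝ) :
    ∫ t, gaussianBetaKernel u v (t, s) = (Ioi (0 : ℝ)).indicator (fun s : ℝ =>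
      Complex.betaIntegral u v * ((s : ℂ) ^ (u + v - 1) * Complex.exp (-(s : ℂ) ^ 2))) s := by
  rcases le_or_gt s 0 with hs | hs
  · simp [gaussianBetaKernel_of_nonpos u v hs, hs]
  · simp_rw [gaussianBetaKernel_eq_indicator]
    rw [integral_indicator measurableSet_Ioo, integral_mul_const, ← integral_Ioc_eq_integral_Ioo,
      ← intervalIntegral.integral_of_le hs.le, Complex.betaIntegral_scaled u v hs,
      indicator_of_mem (mem_Ioi.mpr hs)]
    ring

theorem integrable_gaussianBetaKernel {u v : ℂ} (hu : 0 < u.re) (hv : 0 < v.re) :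
    Integrable (gaussianBetaKernel u v) (volume.prod volume) := by
  rw [integrable_prod_iff' (measurable_gaussianBetaKernel u v).aestronglyMeasurable]
  refine ⟨Filter.Eventually.of_forall (integrable_gaussianBetaKernel_left hu hv), ?_⟩
  have h : ∀ s : ℝ, ((∫ t, ‖gaussianBetaKernel u v (t, s)‖ : ℝ) : ℂ) =
      ∫ t, gaussianBetaKernel u.re v.re (t, s) := by
    intro s
    rw [← integral_complex_ofReal]
    simp_rw [norm_gaussianBetaKernel]
  have hc : Integrable (fun s => ((∫ t, ‖gaussianBetaKernel u v (t, s)‖ : ℝ) : ℂ)) := by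
    simp only [h, integral_gaussianBetaKernel_left]
    rw [integrable_indicator_iff measurableSet_Ioi]
    exact (integrableOn_cpow_mul_cexp_neg_sq _ (by simp; linarith)).const_mul _
  simpa using hc.re

theorem integral_gaussianBetaKernel {u v : ℂ} (hu : 0 < u.re) (hv : 0 < v.re) :
    ∫ p, gaussianBetaKernel u v p ∂(volume.prod volume) =
      Complex.betaIntegral u v * (Complex.Gamma ((u + v) / 2) / 2) := by
  rw [integral_prod_symm _ (integrable_gaussianBetaKernel hu hv)]
  simp_rw [integral_gaussianBetaKernel_left]
  rw [integral_indicator measurableSet_Ioi, integral_const_mul,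
    integral_cpow_mul_cexp_neg_sq _ (by simp; linarith)]

/-! ### Integral representation in negative degree -/

/-- Together with its odd analogue, this matches the even and odd terms of the series of `exp(-2xt)`
with the two Kummer series; `4^m` cancels against `(-2x)^(2m)`. -/
theorem factorial_two_mul_eq_ascPochhammer (m : ℕ) :
    ((2 * m).factorial : ℂ) = 4 ^ m * ((ascPochhammer ℂ m).eval (1 / 2) * m.factorial) := by
  induction m with
  | zero => simp
  | succ m ih =>
    rw [mul_add_one, Nat.factorial_succ, Nat.factorial_succ, Nat.factorial_succ,
      ascPochhammer_succ_eval]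
    push_cast
    rw [ih]
    ring

theorem factorial_two_mul_add_one_eq_ascPochhammer (m : ℕ) :
    ((2 * m + 1).factorial : ℂ) =
      4 ^ m * ((ascPochhammer ℂ m).eval (3 / 2) * m.factorial) := by
  induction m with
  | zero => simp
  | succ m ih =>
    rw [show 2 * (m + 1) + 1 = 2 * m + 1 + 1 + 1 by ring, Nat.factorial_succ, Nat.factorial_succ,
      Nat.factorial_succ m, ascPochhammer_succ_eval]
    push_cast
    rw [ih]
    ring

theorem Complex.ne_neg_nat_of_re_pos {s : ℂ} (hs : 0 < s.re) (k : ℕ) : s ≠ -k := by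
  rintro rfl
  have hk : (0 : ℝ) ≤ k := k.cast_nonneg
  simp at hs
  linarith

/-- Power series of the Hermite function of degree with negative real part. -/
theorem hermiteFunction_hasSum {τ : ℂ} (hτ : τ.re < 0) (x : ℂ) :
    HasSum (fun n : ℕ => (-2 * x) ^ n / (n.factorial : ℂ) * (Complex.Gamma ((n - τ) / 2) / 2))
      (Complex.Gamma (-τ) * hermiteFunction τ x) := by
  have hs : 0 < (-τ / 2).re := by simp; linarith
  have hs' : 0 < ((1 - τ) / 2).re := by simp; linarith
  have h32 : 0 < (3 / 2 : ℂ).re := by norm_num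
  have hG : Complex.Gamma (-τ / 2) ≠ 0 := Complex.Gamma_ne_zero_of_re_pos hs
  have hG' : Complex.Gamma ((1 - τ) / 2) ≠ 0 := Complex.Gamma_ne_zero_of_re_pos hs'
  -- Duplication at `-τ/2` turns the two prefactors, times `Γ(-τ)`, into `Γ(-τ/2)/2` and `-x
  -- Γ((1-τ)/2)`.
  have dup := Complex.Gamma_mul_Gamma_add_half (-τ / 2)
  rw [show -τ / 2 + 1 / 2 = (1 - τ) / 2 by ring, show 2 * (-τ / 2) = -τ by ring,
    show 1 - -τ = τ + 1 by ring, Complex.cpow_add _ _ two_ne_zero, Complex.cpow_one] at dup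
  have hE := (confluentHypergeometric_hasSum (-τ / 2) (1 / 2) (x ^ 2)
    one_half_ne_neg_nat).mul_left (Complex.Gamma (-τ / 2) / 2)
  have hO := (confluentHypergeometric_hasSum ((1 - τ) / 2) (3 / 2) (x ^ 2)
    (Complex.ne_neg_nat_of_re_pos h32)).mul_left (-x * Complex.Gamma ((1 - τ) / 2))
  have hval : Complex.Gamma (-τ) * hermiteFunction τ x =
      Complex.Gamma (-τ / 2) / 2 * confluentHypergeometric (-τ / 2) (1 / 2) (x ^ 2) +
      -x * Complex.Gamma ((1 - τ) / 2) *
        confluentHypergeometric ((1 - τ) / 2) (3 / 2) (x ^ 2) := by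
    unfold hermiteFunction
    rw [Complex.Gamma_one_half_eq_sqrt_pi, Complex.Gamma_neg_one_half_eq]
    generalize confluentHypergeometric (-τ / 2) (1 / 2) (x ^ 2) = M
    generalize confluentHypergeometric ((1 - τ) / 2) (3 / 2) (x ^ 2) = N
    generalize Complex.Gamma (-τ / 2) = A at dup hG ⊢
    generalize Complex.Gamma ((1 - τ) / 2) = B at dup hG' ⊢
    generalize Complex.Gamma (-τ) = C at dup ⊢
    field_simp
    linear_combination (2 * x * B * N - M * A) * dup
  rw [hval]
  refine HasSum.even_add_odd (hE.congr_fun fun m => ?_) (hO.congr_fun fun m => ?_)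
  · rw [← Complex.Gamma_add_nat_div_Gamma_eq _ (Complex.ne_neg_nat_of_re_pos hs),
      factorial_two_mul_eq_ascPochhammer, pow_mul,
      show ((2 * m : ℕ) - τ : ℂ) / 2 = -τ / 2 + m by push_cast; ring,
      show (-2 * x) ^ 2 = 4 * x ^ 2 by ring, mul_pow]
    generalize Complex.Gamma (-τ / 2) = A at hG ⊢
    field_simp
  · rw [← Complex.Gamma_add_nat_div_Gamma_eq _ (Complex.ne_neg_nat_of_re_pos hs'),
      factorial_two_mul_add_one_eq_ascPochhammer, pow_succ, pow_mul,
      show ((2 * m + 1 : ℕ) - τ : ℂ) / 2 = (1 - τ) / 2 + m by push_cast; ring,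
      show (-2 * x) ^ 2 = 4 * x ^ 2 by ring, mul_pow]
    field_simp

theorem integrableOn_rpow_mul_exp_neg_sq_mul_exp_abs {r : ℝ} (hr : -1 < r) (x : ℝ) :
    IntegrableOn (fun t : ℝ => t ^ r * Real.exp (-t ^ 2) * Real.exp |2 * x * t|) (Ioi 0) := by
  have h := (integrableOn_rpow_mul_exp_neg_mul_sq (b := 1 / 2) (by norm_num) hr).mul_const
    (Real.exp (2 * x ^ 2))
  refine Integrable.mono' h (Measurable.aestronglyMeasurable (by fun_prop)) ?_
  filter_upwards [ae_restrict_mem measurableSet_Ioi] with t ht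
  have ht0 : (0 : ℝ) < t := ht
  rw [Real.norm_of_nonneg (by positivity), mul_assoc (t ^ r), mul_assoc (t ^ r), ← Real.exp_add,
    ← Real.exp_add]
  refine mul_le_mul_of_nonneg_left (Real.exp_le_exp.mpr ?_) (by positivity)
  -- From `(t ± 2x)² ≥ 0`; half of the Gaussian decay remains.
  have : |2 * x * t| ≤ t ^ 2 / 2 + 2 * x ^ 2 := by
    rw [abs_le]
    constructor <;> nlinarith [sq_nonneg (t - 2 * x), sq_nonneg (t + 2 * x)]
  linarith

/-- Integral representation of the Hermite function of degree with negative real part. -/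
theorem integral_eq_Gamma_mul_hermiteFunction {τ : ℂ} (hτ : τ.re < 0) (x : ℝ) :
    ∫ t in Ioi (0 : ℝ), (t : ℂ) ^ (-τ - 1) * Complex.exp (-(t : ℂ) ^ 2) *
        Complex.exp (-2 * x * t) =
      Complex.Gamma (-τ) * hermiteFunction τ x := by
  have hnorm : ∀ t ∈ Ioi (0 : ℝ), ‖(t : ℂ) ^ (-τ - 1) * Complex.exp (-(t : ℂ) ^ 2)‖ =
      t ^ (-τ.re - 1) * Real.exp (-t ^ 2) := by
    intro t ht
    rw [norm_mul, Complex.norm_cpow_eq_rpow_re_of_pos ht, ← Complex.ofReal_pow,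
      ← Complex.ofReal_neg, Complex.norm_exp_ofReal]
    simp
  have hexp : ∀ y : ℝ, HasSum (fun n : ℕ => y ^ n / n.factorial) (Real.exp y) := by
    intro y
    rw [Real.exp_eq_exp_ℝ]
    exact NormedSpace.expSeries_div_hasSum_exp y
  -- Termwise integration: the bounds sum to the Gaussian weight times `exp |2xt|`, which is
  -- integrable.
  have hsum := hasSum_integral_of_dominated_convergence (μ := volume.restrict (Ioi (0 : ℝ)))
    (F := fun (n : ℕ) (t : ℝ) => (t : ℂ) ^ (-τ - 1) * Complex.exp (-(t : ℂ) ^ 2) *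
      ((-2 * x * t) ^ n / (n.factorial : ℂ)))
    (f := fun t : ℝ => (t : ℂ) ^ (-τ - 1) * Complex.exp (-(t : ℂ) ^ 2) *
      Complex.exp (-2 * x * t))
    (bound := fun n t => t ^ (-τ.re - 1) * Real.exp (-t ^ 2) *
      (|2 * x * t| ^ n / n.factorial))
    (fun n => Measurable.aestronglyMeasurable (by fun_prop)) ?_ ?_ ?_ ?_
  · refine hsum.unique ((hermiteFunction_hasSum hτ x).congr_fun fun n => ?_)
    have hn : 0 < ((n : ℂ) - τ).re := by
      have hk : (0 : ℝ) ≤ n := n.cast_nonneg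
      simp
      linarith
    rw [← integral_cpow_mul_cexp_neg_sq _ hn, ← integral_const_mul]
    refine setIntegral_congr_fun measurableSet_Ioi fun t ht => ?_
    have ht0 : (t : ℂ) ≠ 0 := Complex.ofReal_ne_zero.mpr (ne_of_gt ht)
    have hp : (t : ℂ) ^ ((n : ℂ) - τ - 1) = (t : ℂ) ^ n * (t : ℂ) ^ (-τ - 1) := by
      rw [← Complex.cpow_natCast, ← Complex.cpow_add _ _ ht0]
      congr 1
      ring
    rw [hp, mul_pow _ (t : ℂ)]
    ring
  · intro n
    filter_upwards [ae_restrict_mem measurableSet_Ioi] with t ht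
    rw [norm_mul, hnorm t ht]
    simp [abs_mul]
  · exact Filter.Eventually.of_forall fun t => (hexp _).summable.mul_left _
  · simp_rw [tsum_mul_left, (hexp _).tsum_eq]
    exact integrableOn_rpow_mul_exp_neg_sq_mul_exp_abs (by linarith) x
  · refine Filter.Eventually.of_forall fun t => HasSum.mul_left _ ?_
    rw [Complex.exp_eq_exp_ℂ]
    exact NormedSpace.expSeries_div_hasSum_exp _

/-! ### The moment formula in negative degree -/

theorem integral_gaussianBetaKernel_add {τ : ℂ} (hτ : τ.re < 0) (z : ℂ) (x : ℝ) :
    ∫ t, gaussianBetaKernel (-τ) (z + 1) (t, t + x) = (Ioi (0 : ℝ)).indicator (fun x : ℝ =>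
      Complex.Gamma (-τ) *
        ((x : ℂ) ^ z * hermiteFunction τ x * Complex.exp (-(x : ℂ) ^ 2))) x := by
  by_cases hx : x ∈ Ioi (0 : ℝ)
  · rw [indicator_of_mem hx]
    have hx0 : 0 < x := hx
    have h : ∀ t, gaussianBetaKernel (-τ) (z + 1) (t, t + x) = (Ioi (0 : ℝ)).indicator
        (fun t : ℝ => ((x : ℂ) ^ z * Complex.exp (-(x : ℂ) ^ 2)) * ((t : ℂ) ^ (-τ - 1) *
          Complex.exp (-(t : ℂ) ^ 2) * Complex.exp (-2 * x * t))) t := by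
      intro t
      have hexp : Complex.exp (-((t + x : ℝ) : ℂ) ^ 2) = Complex.exp (-(x : ℂ) ^ 2) *
          Complex.exp (-(t : ℂ) ^ 2) * Complex.exp (-2 * x * t) := by
        rw [← Complex.exp_add, ← Complex.exp_add]
        congr 1
        push_cast
        ring
      by_cases ht : 0 < t
      · simp only [gaussianBetaKernel, indicator_apply, mem_ofPred_eq, mem_Ioi, ht, hexp,
          lt_add_iff_pos_right, hx0, and_self, if_true, add_sub_cancel_left, add_sub_cancel_right]
        ring
      · simp [gaussianBetaKernel, ht]
    simp_rw [h]
    rw [integral_indicator measurableSet_Ioi, integral_const_mul,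
      integral_eq_Gamma_mul_hermiteFunction hτ]
    ring
  · rw [indicator_of_notMem hx]
    have : ¬ 0 < x := hx
    simp [gaussianBetaKernel, this]

theorem hermiteFunction_moment_of_re_neg {z τ : ℂ} (hz : -1 < z.re) (hτ : τ.re < 0) :
    IntegrableOn (fun x : ℝ =>
        (x : ℂ) ^ z * hermiteFunction τ (x : ℂ) * Complex.exp (-(x : ℂ) ^ 2)) (Ioi (0 : ℝ)) ∧
      ∫ x in Ioi (0 : ℝ), (x : ℂ) ^ z * hermiteFunction τ (x : ℂ) *
          Complex.exp (-(x : ℂ) ^ 2) =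
        ((Real.sqrt Real.pi : ℝ) : ℂ) / (2 : ℂ) ^ (z - τ + 1) *
          (Complex.Gamma (z + 1) / Complex.Gamma ((z - τ) / 2 + 1)) := by
  have hu : 0 < (-τ).re := by simpa using hτ
  have hv : 0 < (z + 1).re := by simp; linarith
  have hG : Complex.Gamma (-τ) ≠ 0 := Complex.Gamma_ne_zero_of_re_pos hu
  -- The shear `(t, x) ↦ (t, t + x)` preserves Lebesgue measure, so the kernel can be integrated in
  -- either set of coordinates.
  have hmp := measurePreserving_prod_add (volume : Measure ℝ) (volume : Measure ℝ)
  have hK := integrable_gaussianBetaKernel hu hv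
  have hL := hmp.integrable_comp_of_integrable hK
  have hval := integral_gaussianBetaKernel hu hv
  rw [← hmp.map_eq, integral_map hmp.measurable.aemeasurable
    (measurable_gaussianBetaKernel _ _).aestronglyMeasurable] at hval
  change Integrable (fun p : ℝ × ℝ => gaussianBetaKernel (-τ) (z + 1) (p.1, p.1 + p.2)) _ at hL
  have hI := hL.integral_prod_right
  rw [integral_prod_symm _ hL] at hval
  simp only [integral_gaussianBetaKernel_add hτ] at hI hval
  rw [integrable_indicator_iff measurableSet_Ioi] at hI
  rw [integral_indicator measurableSet_Ioi, integral_const_mul] at hval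
  refine ⟨(integrable_const_mul_iff hG.isUnit _).mp hI, mul_left_cancel₀ hG ?_⟩
  have hbeta := Complex.Gamma_mul_Gamma_eq_betaIntegral hu hv
  have dup := Complex.Gamma_mul_Gamma_add_half ((-τ + (z + 1)) / 2)
  rw [show (-τ + (z + 1)) / 2 + 1 / 2 = (z - τ) / 2 + 1 by ring,
    show 2 * ((-τ + (z + 1)) / 2) = -τ + (z + 1) by ring,
    show 1 - (-τ + (z + 1)) = 1 - (z - τ + 1) by ring, Complex.cpow_sub _ _ two_ne_zero,
    Complex.cpow_one] at dup
  have h1 : Complex.Gamma ((z - τ) / 2 + 1) ≠ 0 :=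
    Complex.Gamma_ne_zero_of_re_pos (by simp; linarith)
  have h2 : Complex.Gamma (-τ + (z + 1)) ≠ 0 :=
    Complex.Gamma_ne_zero_of_re_pos (by rw [Complex.add_re]; positivity)
  have h3 : (2 : ℂ) ^ (z - τ + 1) ≠ 0 := by simp [Complex.cpow_eq_zero_iff]
  rw [hval]
  have hb : Complex.betaIntegral (-τ) (z + 1) =
      Complex.Gamma (-τ) * Complex.Gamma (z + 1) / Complex.Gamma (-τ + (z + 1)) := by
    rw [hbeta, mul_div_cancel_left₀ _ h2]
  rw [hb]
  generalize Complex.Gamma ((-τ + (z + 1)) / 2) = A at dup ⊢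
  generalize Complex.Gamma ((z - τ) / 2 + 1) = B at dup h1 ⊢
  generalize Complex.Gamma (-τ + (z + 1)) = C at dup h2 ⊢
  field_simp at dup ⊢
  linear_combination Complex.Gamma (z + 1) * dup

/-! ### Extension to all degrees -/

/-- With `w = (z-τ+1)/2`, the right side carries the factor `(z+1) - τ = 2w`, which `1/Γ(w) =
w/Γ(w+1)` supplies on the left, even at zeros of `1/Γ`. -/
theorem hermiteFunction_moment_rhs_recurrence (z τ : ℂ) (hz : z + 1 ≠ 0) :
    ((Real.sqrt Real.pi : ℝ) : ℂ) / (2 : ℂ) ^ (z - (τ + 1) + 1) *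
        (Complex.Gamma (z + 1) / Complex.Gamma ((z - (τ + 1)) / 2 + 1)) =
      2 * (((Real.sqrt Real.pi : ℝ) : ℂ) / (2 : ℂ) ^ (z + 1 - τ + 1) *
        (Complex.Gamma (z + 1 + 1) / Complex.Gamma ((z + 1 - τ) / 2 + 1))) -
      2 * τ * (((Real.sqrt Real.pi : ℝ) : ℂ) / (2 : ℂ) ^ (z - (τ - 1) + 1) *
        (Complex.Gamma (z + 1) / Complex.Gamma ((z - (τ - 1)) / 2 + 1))) := by
  have g := Complex.one_div_Gamma_eq_self_mul_one_div_Gamma_add_one ((z - τ + 1) / 2)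
  have p : (2 : ℂ) ^ (z - τ + 2) = 2 ^ (z - τ) * 4 := by
    rw [Complex.cpow_add _ _ two_ne_zero]; norm_num
  have h3 : (2 : ℂ) ^ (z - τ) ≠ 0 := by simp [Complex.cpow_eq_zero_iff]
  rw [show z - (τ + 1) + 1 = z - τ by ring, show z + 1 - τ + 1 = z - τ + 2 by ring,
    show z - (τ - 1) + 1 = z - τ + 2 by ring, p, Complex.Gamma_add_one _ hz,
    show (z - (τ + 1)) / 2 + 1 = (z - τ + 1) / 2 by ring,
    show (z + 1 - τ) / 2 + 1 = (z - τ + 1) / 2 + 1 by ring,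
    show (z - (τ - 1)) / 2 + 1 = (z - τ + 1) / 2 + 1 by ring,
    div_eq_mul_inv _ (Complex.Gamma ((z - τ + 1) / 2)), g]
  simp only [div_eq_mul_inv, mul_inv]
  ring

theorem hermiteFunction_moment {z τ : ℂ} (hz : -1 < z.re) :
    IntegrableOn (fun x : ℝ =>
        (x : ℂ) ^ z * hermiteFunction τ (x : ℂ) * Complex.exp (-(x : ℂ) ^ 2)) (Ioi (0 : ℝ)) ∧
      ∫ x in Ioi (0 : ℝ), (x : ℂ) ^ z * hermiteFunction τ (x : ℂ) *
          Complex.exp (-(x : ℂ) ^ 2) =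
        ((Real.sqrt Real.pi : ℝ) : ℂ) / (2 : ℂ) ^ (z - τ + 1) *
          (Complex.Gamma (z + 1) / Complex.Gamma ((z - τ) / 2 + 1)) := by
  obtain ⟨n, hn⟩ := exists_nat_gt τ.re
  -- The exponent must vary: the term of degree `σ` is needed with exponent `z + 1`.
  induction n using Nat.strong_induction_on generalizing z τ with
  | _ n ih =>
    rcases n with _ | n
    · exact hermiteFunction_moment_of_re_neg hz (by simpa using hn)
    · obtain ⟨σ, rfl⟩ : ∃ σ, τ = σ + 1 := ⟨τ - 1, by ring⟩
      push_cast at hn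
      have hσ : σ.re < n := by simp at hn; exact hn
      obtain ⟨i1, e1⟩ := ih n n.lt_succ_self (z := z + 1) (τ := σ) (by simp; linarith) hσ
      obtain ⟨i2, e2⟩ := ih n n.lt_succ_self (z := z) (τ := σ - 1) hz (by simp; linarith)
      have hz1 : z + 1 ≠ 0 := by
        intro h
        have := congrArg Complex.re h
        simp at this
        linarith
      have hrec : EqOn (fun x : ℝ => 2 * ((x : ℂ) ^ (z + 1) * hermiteFunction σ (x : ℂ) *
            Complex.exp (-(x : ℂ) ^ 2)) - 2 * σ * ((x : ℂ) ^ z * hermiteFunction (σ - 1) (x : ℂ) *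
            Complex.exp (-(x : ℂ) ^ 2)))
          (fun x : ℝ => (x : ℂ) ^ z * hermiteFunction (σ + 1) (x : ℂ) *
            Complex.exp (-(x : ℂ) ^ 2)) (Ioi 0) := by
        intro x hx
        have hx0 : (x : ℂ) ≠ 0 := Complex.ofReal_ne_zero.mpr (ne_of_gt hx)
        simp only
        rw [hermiteFunction_add_one, Complex.cpow_add _ _ hx0, Complex.cpow_one]
        ring
      refine ⟨IntegrableOn.congr_fun ((i1.const_mul 2).sub (i2.const_mul (2 * σ))) hrec
        measurableSet_Ioi, ?_⟩
      rw [← setIntegral_congr_fun measurableSet_Ioi hrec,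
        integral_sub (i1.const_mul 2) (i2.const_mul (2 * σ)), integral_const_mul,
        integral_const_mul, e1, e2, hermiteFunction_moment_rhs_recurrence z σ hz1]

end

theorem mainTheorem2 (z τ : ℂ) (hz : -1 < z.re) :
    (MeasureTheory.IntegrableOn
        (fun x : ℝ => (x : ℂ) ^ z * hermiteFunction τ (x : ℂ) * Complex.exp (-(x : ℂ) ^ 2))
        (Set.Ioi (0 : ℝ)) MeasureTheory.volume ∧
      ∫ x in Set.Ioi (0 : ℝ),
          (x : ℂ) ^ z * hermiteFunction τ (x : ℂ) * Complex.exp (-(x : ℂ) ^ 2) =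
        ((Real.sqrt Real.pi : ℝ) : ℂ) / (2 : ℂ) ^ (z - τ + 1) *
          (Complex.Gamma (z + 1) / Complex.Gamma ((z - τ) / 2 + 1))) ∧
    (MeasureTheory.Integrable
        (fun x : ℝ => ((|x| : ℝ) : ℂ) ^ z * hermiteFunction τ ((|x| : ℝ) : ℂ) *
          Complex.exp (-(x : ℂ) ^ 2))
        MeasureTheory.volume ∧
      ∫ x : ℝ, ((|x| : ℝ) : ℂ) ^ z * hermiteFunction τ ((|x| : ℝ) : ℂ) *
          Complex.exp (-(x : ℂ) ^ 2) =
        ((Real.sqrt Real.pi : ℝ) : ℂ) / (2 : ℂ) ^ (z - τ) *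
          (Complex.Gamma (z + 1) / Complex.Gamma ((z - τ) / 2 + 1))) := by

  obtain ⟨hi, he⟩ := hermiteFunction_moment (z := z) (τ := τ) hz
  have habs : (fun x : ℝ => ((|x| : ℝ) : ℂ) ^ z * hermiteFunction τ ((|x| : ℝ) : ℂ) *
      Complex.exp (-(x : ℂ) ^ 2)) = fun x : ℝ => (fun y : ℝ => (y : ℂ) ^ z *
        hermiteFunction τ (y : ℂ) * Complex.exp (-(y : ℂ) ^ 2)) |x| := by
    funext x
    simp only [← Complex.ofReal_pow, sq_abs]
  refine ⟨⟨hi, he⟩, ?_, ?_⟩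
  · rw [habs]
    exact integrable_comp_abs hi
  -- The factor 2 from the two half-lines lowers the power of 2 in the denominator by one.
  · rw [habs, integral_comp_abs_complex hi, he, Complex.cpow_add _ _ two_ne_zero,
      Complex.cpow_one]
    field_simp
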